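/- Let $X$ be a complex Banach space and let $\Phi$ be a Banach function space over $(\mathbb{R},\mathrm{d}t)$: a Banach space of (classes of) complex measurable functions on $\mathbb{R}$ which is an order ideal ($|f|\le|g|$ a.e., $f$ measurable, $g\in\Phi$ imply $f\in\Phi$ and $\|f\|_\Phi\le\|g\|_\Phi$) and has Fatou's property (if $0\le f_n\uparrow f$ a.e., then $\|f_n\|_\Phi\uparrow\|f\|_\Phi$, where $\|f\|_\Phi:=\infty$ for $f\notin\Phi$). Let $\Phi'$ be its Köthe dual, with norm $\|g\|_{\Phi'}=\sup\{\int_{\mathbb{R}}|fg|\,\mathrm{d}t:\ \|f\|_\Phi\le1\}$, and assume that the Hardy–Littlewood maximal operator $M$ is bounded on $\Phi$ and on $\Phi'$. Let $\Phi(X)$ be the space of strongly measurable $f:\mathbb{R}\to X$ with $\|f\|_{\Phi(X)}:=\||f|_X\|_\Phi<\infty$. Let $\psi\in C_c^\infty(\mathbb{R})$ satisfy $\psi=1$ on $[-1,1]$ and $\operatorname{supp}\psi\subset[-2,2]$, and put $\psi_0:=\psi$, $\psi_j:=\psi(2^{-j}\cdot)-\psi(2^{-j+1}\cdot)$ for $j\ge1$,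 and $\psi_j(D)f:=\mathcal{F}^{-1}(\psi_j\,\mathcal{F}f)$ for $f\in\mathcal{S}'(X)$, the space of $X$-valued tempered distributions on $\mathbb{R}$, where $\mathcal{F}$ is the Fourier transform with kernel $e^{-it\xi}$. For $s\in\mathbb{R}$ and $q\in[1,\infty]$ let $$B^{s,q}_\Phi(X):=\Big\{f\in\mathcal{S}'(X):\ \|f\|_{B^{s,q}_\Phi(X)}:=\Big(\sum_{j=0}^\infty\|2^{sj}\psi_j(D)f\|_{\Phi(X)}^q\Big)^{1/q}<\infty\Big\},$$ with the supremum over $j$ if $q=\infty$, and with $\|u\|_{\Phi(X)}:=\infty$ for a distribution $u$ that is not a regular one given by an element of $\Phi(X)$. Then, for all $s\in\mathbb{R}$, $q\in[1,\infty]$ and every $f\in\mathcal{S}'(X)$, $f$ belongs to $B^{s,q}_\Phi(X)$ if and only if both $f$ and its distributional derivative $\partial f$ belong to $B^{s-1,q}_\Phi(X)$. Moreover, the function $$B^{s,q}_\Phi(X)\ni f\mapsto\|f\|_{B^{s-1,q}_\Phi(X)}+\|\partial f\|_{B^{s-1,q}_\Phi(X)}$$ is an equivalent norm on $B^{s,q}_\Phi(X)$: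 it and $\|\cdot\|_{B^{s,q}_\Phi(X)}$ are norms on this linear space, and each is bounded by a constant multiple of the other. -/

import Mathlib

open MeasureTheory Set
open scoped ENNReal NNReal SchwartzMap

noncomputable section

/-- A Banach function space `Φ` over `(ℝ, dt)`, given by its function norm
`ρ : f ↦ ‖f‖_Φ ∈ [0, ∞]` on nonnegative measurable functions (the values of `ρ` at functions that
are not a.e.-measurable play no role). The space itself consists of the measurable `f` with
`ρ(|f|) < ∞`. The field `mono` is the ideal property, and it makes `ρ` depend only on a.e.-classes;
the field `fatou` is Fatou's property, which entails completeness. -/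
structure BanachFunctionSpace where
  /-- the function norm -/
  norm : (ℝ → ℝ≥0∞) → ℝ≥0∞
  norm_eq_zero_iff : ∀ f, AEMeasurable f volume → (norm f = 0 ↔ f =ᵐ[volume] 0)
  norm_smul : ∀ (c : ℝ≥0) (f : ℝ → ℝ≥0∞), AEMeasurable f volume →
    norm (fun t => c * f t) = c * norm f
  norm_add_le : ∀ f g : ℝ → ℝ≥0∞, AEMeasurable f volume → AEMeasurable g volume →
    norm (fun t => f t + g t) ≤ norm f + norm g
  mono : ∀ f g : ℝ → ℝ≥0∞, AEMeasurable f volume → AEMeasurable g volume →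
    (∀ᵐ t ∂volume, f t ≤ g t) → norm f ≤ norm g
  fatou : ∀ f : ℕ → ℝ → ℝ≥0∞, (∀ n, AEMeasurable (f n) volume) →
    (∀ᵐ t ∂volume, Monotone fun n => f n t) →
    norm (fun t => ⨆ n, f n t) = ⨆ n, norm (f n)

/-- The norm of the Köthe dual (associate space) `Φ'`:
`‖g‖_{Φ'} = sup {∫ f g dt : f ≥ 0, ‖f‖_Φ ≤ 1}`. -/
def BanachFunctionSpace.dualNorm (Φ : BanachFunctionSpace) (g : ℝ → ℝ≥0∞) : ℝ≥0∞ :=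
  ⨆ (f : ℝ → ℝ≥0∞) (_ : AEMeasurable f volume) (_ : Φ.norm f ≤ 1), ∫⁻ t, f t * g t

/-- The (uncentred) Hardy-Littlewood maximal function of a nonnegative function on `ℝ`. -/
def hardyLittlewood (f : ℝ → ℝ≥0∞) (t : ℝ) : ℝ≥0∞ :=
  ⨆ (a : ℝ) (b : ℝ) (_ : t ∈ Ioo a b), (∫⁻ r in Ioo a b, f r) / ENNReal.ofReal (b - a)

/-- The Hardy-Littlewood operator is bounded on the space with function norm `N`. -/
def HardyLittlewoodBoundedOn (N : (ℝ → ℝ≥0∞) → ℝ≥0∞) : Prop :=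
  ∃ C : ℝ≥0, ∀ f : ℝ → ℝ≥0∞, AEMeasurable f volume → N f < ∞ →
    N (hardyLittlewood f) ≤ C * N f

/-- `ψ` generates a resolution of the identity: `ψ` is a test function with `ψ = 1` on `[-1, 1]`
and `supp ψ ⊆ [-2, 2]`. -/
structure IsDyadicGenerator (ψ : ℝ → ℂ) : Prop where
  smooth : ContDiff ℝ (⊤ : ℕ∞) ψ
  eq_one : ∀ t ∈ Icc (-1 : ℝ) 1, ψ t = 1
  support : tsupport ψ ⊆ Icc (-2 : ℝ) 2

/-- `ψ_0 = ψ` and `ψ_j = ψ(2^{-j} ·) - ψ(2^{-j+1} ·)` for `j ≥ 1`. -/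
def dyadicPiece (ψ : ℝ → ℂ) : ℕ → ℝ → ℂ
  | 0 => ψ
  | j + 1 => fun t => ψ (t / 2 ^ (j + 1)) - ψ (t / 2 ^ j)

variable {X : Type*} [NormedAddCommGroup X] [NormedSpace ℂ X]

/-- The Fourier multiplier `a(D) = 𝓕⁻¹ a 𝓕` on `𝓢'(ℝ, X)` for the Fourier transform with kernel
`exp(-i t ξ)`, so that `D = -i ∂`. Mathlib's transform has the kernel `exp(-2π i t ξ)`, whence the
dilation of the symbol. -/
def symbolD (a : ℝ → ℂ) : 𝓢'(ℝ, X) →L[ℂ] 𝓢'(ℝ, X) :=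
  TemperedDistribution.fourierMultiplierCLM X fun ξ => a (2 * Real.pi * ξ)

/-- The tempered distribution `u` is regular and given by the locally integrable function `g`. -/
def IsRepresentedBy (u : 𝓢'(ℝ, X)) (g : ℝ → X) : Prop :=
  LocallyIntegrable g volume ∧
    ∀ φ : 𝓢(ℝ, ℂ), HasCompactSupport φ → u φ = ∫ t, φ t • g t

/-- `‖u‖_{Φ(X)} = ‖ |u|_X ‖_Φ` for a tempered distribution `u`; this is `∞` if `u` is not a
regular distribution. (A function `g` representing `u` is unique up to null sets.) -/
def BanachFunctionSpace.distNorm (Φ : BanachFunctionSpace) (u : 𝓢'(ℝ, X)) : ℝ≥0∞ :=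
  ⨅ (g : ℝ → X) (_ : IsRepresentedBy u g), Φ.norm fun t => ‖g t‖ₑ

/-- The Besov norm `(∑_j ‖2^{sj} ψ_j(D) f‖_{Φ(X)}^q)^{1/q}`, with the supremum for `q = ∞`. -/
def besovNorm (ψ : ℝ → ℂ) (Φ : BanachFunctionSpace) (s : ℝ) (q : ℝ≥0∞) (f : 𝓢'(ℝ, X)) : ℝ≥0∞ :=
  if q = ∞ then
    ⨆ j : ℕ, ENNReal.ofReal (2 ^ (s * j)) * Φ.distNorm (symbolD (dyadicPiece ψ j) f)
  else
    (∑' j : ℕ, (ENNReal.ofReal (2 ^ (s * j)) *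
      Φ.distNorm (symbolD (dyadicPiece ψ j) f)) ^ q.toReal) ^ (1 / q.toReal)

variable (X) in
/-- The Besov space `B^{s,q}_Φ(X)`. -/
def besovSpace (ψ : ℝ → ℂ) (Φ : BanachFunctionSpace) (s : ℝ) (q : ℝ≥0∞) : Set 𝓢'(ℝ, X) :=
  {f | besovNorm ψ Φ s q f < ∞}

/-- `V` is a complex linear subspace of `E`, and `N` restricts to a norm on `V`. -/
structure IsNormOn {E : Type*} [AddCommGroup E] [Module ℂ E] (V : Set E) (N : E → ℝ≥0∞) :
    Prop where
  zero_mem : (0 : E) ∈ V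
  add_mem : ∀ f ∈ V, ∀ g ∈ V, f + g ∈ V
  smul_mem : ∀ (c : ℂ), ∀ f ∈ V, c • f ∈ V
  lt_top : ∀ f ∈ V, N f < ∞
  eq_zero_iff : ∀ f ∈ V, (N f = 0 ↔ f = 0)
  smul : ∀ (c : ℂ), ∀ f ∈ V, N (c • f) = ‖c‖ₑ * N f
  add_le : ∀ f ∈ V, ∀ g ∈ V, N (f + g) ≤ N f + N g

/-- `N₁` and `N₂` are equivalent norms on the linear space `V`. -/
def AreEquivalentNormsOn {E : Type*} [AddCommGroup E] [Module ℂ E] (V : Set E)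
    (N₁ N₂ : E → ℝ≥0∞) : Prop :=
  IsNormOn V N₁ ∧ IsNormOn V N₂ ∧
    ∃ c C : ℝ≥0, 0 < c ∧ 0 < C ∧ ∀ f ∈ V, c * N₁ f ≤ N₂ f ∧ N₂ f ≤ C * N₁ f

end

/-!
The dyadic pieces of `f` and `∂f` are compared one frequency at a time. On the annulus
`|ξ| ~ 2 ^ j` the symbol `iξ` of the derivative equals `2 ^ j` times the `2 ^ j`-dilate of a fixed
test function vanishing near the origin, and `1 / (iξ)` equals `2 ^ (-j)` times the `2 ^ j`-dilate
of another.
Hence, once the dilated multipliers `m(D / l)`, `l > 0`, of a test function `m` are known to be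
uniformly bounded on `Φ(X)`, each term of the Besov norm of order `s - 1` of `∂f` is comparable with
the term of order `s` of `f`, except for the inverse direction at `j = 0`, where the derivative is
not invertible and the term of `f` itself in order `s - 1` takes over. Taking `ℓ^q` norms gives both
inequalities (`exists_besovNorm_derivCLM_le`, `exists_besovNorm_le_add`).

The uniform multiplier bound (`BanachFunctionSpace.exists_distNorm_symbolD_dilate_le`) comes from
the pointwise estimate of a convolution with the dilates of an integrable radially decreasing kernel
by the Hardy-Littlewood maximal function (`lintegral_cauchyKernel_mul_le_hardyLittlewood`). For
a density `g` of finite norm, finiteness of the maximal function at one point already forces `g` to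
be locally integrable and integrable against every Schwartz function, so that the multiplier acts on
the distribution as convolution of `g` with a Schwartz kernel.

Definiteness of the norms rests on the convergence in `𝓢` of the truncations of a Schwartz function
(`SchwartzMap.tendsto_smulLeftCLM_dilate`), which on the frequency side says that the dyadic pieces
determine a tempered distribution, and the triangle inequality is that of `ℓ^q`.
-/

section

variable {X : Type*} [NormedAddCommGroup X] [NormedSpace ℂ X]

/-! ### The Hardy-Littlewood maximal function -/

theorem lowerSemicontinuous_hardyLittlewood (f : ℝ → ℝ≥0∞) :
    LowerSemicontinuous (hardyLittlewood f) := by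
  intro t c hc
  simp only [hardyLittlewood, lt_iSup_iff] at hc
  obtain ⟨a, b, ht, hc⟩ := hc
  filter_upwards [Ioo_mem_nhds ht.1 ht.2] with r hr
  exact hc.trans_le (le_iSup₂_of_le a b (le_iSup_of_le hr le_rfl))

theorem lintegral_Ioo_le_mul_hardyLittlewood (f : ℝ → ℝ≥0∞) {a b t : ℝ} (ht : t ∈ Ioo a b) :
    ∫⁻ r in Ioo a b, f r ≤ ENNReal.ofReal (b - a) * hardyLittlewood f t := by
  have hab : 0 < b - a := by linarith [ht.1, ht.2]
  have h : (∫⁻ r in Ioo a b, f r) / ENNReal.ofReal (b - a) ≤ hardyLittlewood f t :=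
    le_iSup₂_of_le a b (le_iSup_of_le ht le_rfl)
  rwa [ENNReal.div_le_iff' (by simpa using hab) ENNReal.ofReal_ne_top] at h

/-- The dilated Cauchy kernel is dominated by averages over the intervals of radius `2 ^ n / l`
around `s`, with geometrically decaying weights. -/
theorem ofReal_cauchyKernel_le_tsum {l : ℝ} (hl : 0 < l) (s t : ℝ) :
    ENNReal.ofReal (l * (1 + (l * (s - t)) ^ 2)⁻¹) ≤
      ∑' n : ℕ, ENNReal.ofReal (4 * l * (1 / 4) ^ n) *
        (Ioo (s - 2 ^ n / l) (s + 2 ^ n / l)).indicator 1 t := by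
  have hex : ∃ n : ℕ, l * |s - t| < 2 ^ n := pow_unbounded_of_one_lt _ one_lt_two
  classical
  have hn := Nat.find_spec hex
  have hmin : ∀ m, m < Nat.find hex → ¬ l * |s - t| < 2 ^ m := fun m => Nat.find_min hex
  set n := Nat.find hex
  have hmem : t ∈ Ioo (s - 2 ^ n / l) (s + 2 ^ n / l) := by
    have h : |s - t| < 2 ^ n / l := by rwa [lt_div_iff₀ hl, mul_comm]
    rw [abs_lt] at h
    constructor <;> linarith [h.1, h.2]
  refine le_trans ?_ (ENNReal.le_tsum n)
  rw [indicator_of_mem hmem, Pi.one_apply, mul_one]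
  apply ENNReal.ofReal_le_ofReal
  have hx : (l * (s - t)) ^ 2 = (l * |s - t|) ^ 2 := by rw [mul_pow, mul_pow, sq_abs]
  have hx0 : 0 ≤ l * |s - t| := by positivity
  rw [hx, mul_comm 4 l, mul_assoc]
  refine mul_le_mul_of_nonneg_left ?_ hl.le
  rcases hnn : n with _ | m
  · have : (1 + (l * |s - t|) ^ 2)⁻¹ ≤ 1 := inv_le_one_of_one_le₀ (by nlinarith)
    simpa using this.trans (by norm_num)
  · have hm := not_lt.1 (hmin m (by omega))
    have h4 : (4 : ℝ) ^ m ≤ (l * |s - t|) ^ 2 := by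
      calc (4 : ℝ) ^ m = (2 ^ m) ^ 2 := by rw [← pow_mul, mul_comm m 2, pow_mul]; norm_num
        _ ≤ _ := by gcongr
    calc (1 + (l * |s - t|) ^ 2)⁻¹ ≤ (4 ^ m)⁻¹ := by
          apply inv_anti₀ (by positivity); linarith
      _ = 4 * (1 / 4) ^ (m + 1) := by rw [pow_succ, one_div, inv_pow]; ring

/-- Convolution with dilates of the Cauchy kernel is controlled by the maximal function, uniformly
in the dilation. -/
theorem lintegral_cauchyKernel_mul_le_hardyLittlewood {f : ℝ → ℝ≥0∞} (hf : AEMeasurable f volume)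
    {l : ℝ} (hl : 0 < l) (s : ℝ) :
    ∫⁻ t, ENNReal.ofReal (l * (1 + (l * (s - t)) ^ 2)⁻¹) * f t ≤ 16 * hardyLittlewood f s := by
  have hterm : ∀ n : ℕ, ∫⁻ t, ENNReal.ofReal (4 * l * (1 / 4) ^ n) *
      (Ioo (s - 2 ^ n / l) (s + 2 ^ n / l)).indicator 1 t * f t ≤
        ENNReal.ofReal (8 * (1 / 2) ^ n) * hardyLittlewood f s := by
    intro n
    have hpos : 0 < (2 : ℝ) ^ n / l := by positivity
    calc _ = ∫⁻ t, ENNReal.ofReal (4 * l * (1 / 4) ^ n) *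
          (Ioo (s - 2 ^ n / l) (s + 2 ^ n / l)).indicator f t := by
          congr with t
          by_cases h : t ∈ Ioo (s - 2 ^ n / l) (s + 2 ^ n / l)
          · rw [indicator_of_mem h, indicator_of_mem h, Pi.one_apply, mul_one]
          · rw [indicator_of_notMem h, indicator_of_notMem h]; simp
      _ = ENNReal.ofReal (4 * l * (1 / 4) ^ n) *
          ∫⁻ t in Ioo (s - 2 ^ n / l) (s + 2 ^ n / l), f t := by
          rw [lintegral_const_mul' _ _ ENNReal.ofReal_ne_top, lintegral_indicator measurableSet_Ioo]
      _ ≤ ENNReal.ofReal (4 * l * (1 / 4) ^ n) *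
          (ENNReal.ofReal (s + 2 ^ n / l - (s - 2 ^ n / l)) * hardyLittlewood f s) := by
          gcongr
          exact lintegral_Ioo_le_mul_hardyLittlewood f ⟨by linarith, by linarith⟩
      _ = _ := by
          rw [← mul_assoc, ← ENNReal.ofReal_mul (by positivity)]
          congr 2
          have h2 : (1 / 4 : ℝ) ^ n * 2 ^ n = (1 / 2) ^ n := by rw [← mul_pow]; norm_num
          calc 4 * l * (1 / 4) ^ n * (s + 2 ^ n / l - (s - 2 ^ n / l))
              = 8 * ((1 / 4) ^ n * 2 ^ n) * (l / l) := by ring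
            _ = _ := by rw [h2, div_self hl.ne', mul_one]
  calc _ ≤ ∫⁻ t, (∑' n : ℕ, ENNReal.ofReal (4 * l * (1 / 4) ^ n) *
        (Ioo (s - 2 ^ n / l) (s + 2 ^ n / l)).indicator 1 t * f t) := by
        refine lintegral_mono fun t => ?_
        rw [ENNReal.tsum_mul_right]
        gcongr
        exact ofReal_cauchyKernel_le_tsum hl s t
    _ = ∑' n : ℕ, ∫⁻ t, ENNReal.ofReal (4 * l * (1 / 4) ^ n) *
        (Ioo (s - 2 ^ n / l) (s + 2 ^ n / l)).indicator 1 t * f t := by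
        refine lintegral_tsum fun n => ?_
        exact ((measurable_one.indicator measurableSet_Ioo).const_mul _).aemeasurable.mul hf
    _ ≤ ∑' n : ℕ, ENNReal.ofReal (8 * (1 / 2) ^ n) * hardyLittlewood f s :=
        ENNReal.tsum_le_tsum hterm
    _ = 16 * hardyLittlewood f s := by
        rw [ENNReal.tsum_mul_right, ← ENNReal.ofReal_tsum_of_nonneg (fun n => by positivity)
          (summable_geometric_two.mul_left 8), tsum_mul_left, tsum_geometric_two]
        norm_num

/-! ### Banach function spaces on which the maximal operator is bounded -/

namespace BanachFunctionSpace

variable {Φ : BanachFunctionSpace} {f : ℝ → ℝ≥0∞}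

theorem ae_lt_top_of_norm_lt_top (hf : AEMeasurable f volume) (h : Φ.norm f < ∞) :
    ∀ᵐ t ∂volume, f t < ∞ := by
  set g : ℝ → ℝ≥0∞ := fun t => ({∞} : Set ℝ≥0∞).indicator 1 (f t) with hg
  have hgm : AEMeasurable g volume :=
    (measurable_one.indicator (measurableSet_singleton _)).comp_aemeasurable hf
  have hle : ∀ c : ℝ≥0, c * Φ.norm g ≤ Φ.norm f := by
    intro c
    rw [← Φ.norm_smul c g hgm]
    refine Φ.mono _ _ (hgm.const_mul _) hf (.of_forall fun t => ?_)
    by_cases ht : f t = ∞ <;> simp [hg, ht]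
  have h0 : Φ.norm g = 0 := by
    by_contra hne
    obtain ⟨n, hn⟩ := ENNReal.exists_nat_mul_gt hne h.ne
    exact (hle n).not_gt (by simpa using hn)
  filter_upwards [(Φ.norm_eq_zero_iff g hgm).1 h0] with t ht
  refine lt_top_iff_ne_top.2 fun htop => ?_
  simp [hg, htop] at ht

theorem exists_hardyLittlewood_lt_top (hM : HardyLittlewoodBoundedOn Φ.norm)
    (hf : AEMeasurable f volume) (h : Φ.norm f < ∞) : ∃ t, hardyLittlewood f t < ∞ := by
  obtain ⟨C, hC⟩ := hM
  exact (ae_lt_top_of_norm_lt_top (lowerSemicontinuous_hardyLittlewood f).measurable.aemeasurable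
    ((hC f hf h).trans_lt (ENNReal.mul_lt_top ENNReal.coe_lt_top h))).exists

theorem locallyIntegrable_of_norm_lt_top {E : Type*} [NormedAddCommGroup E]
    (hM : HardyLittlewoodBoundedOn Φ.norm) {g : ℝ → E} (hg : AEStronglyMeasurable g volume)
    (h : Φ.norm (fun t => ‖g t‖ₑ) < ∞) : LocallyIntegrable g volume := by
  obtain ⟨s, hs⟩ := exists_hardyLittlewood_lt_top hM hg.enorm h
  refine fun x => ⟨Ioo (s - (|x - s| + 1)) (s + (|x - s| + 1)), ?_, hg.restrict, ?_⟩
  · have := abs_lt.1 (lt_add_one |x - s|)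
    exact Ioo_mem_nhds (by linarith [this.1]) (by linarith [this.2])
  · have := abs_nonneg (x - s)
    exact (lintegral_Ioo_le_mul_hardyLittlewood _ ⟨by linarith, by linarith⟩).trans_lt
      (ENNReal.mul_lt_top ENNReal.ofReal_lt_top hs)

end BanachFunctionSpace

/-! ### Schwartz functions against functions of finite norm -/

theorem SchwartzMap.exists_norm_le_cauchyKernel {F : Type*} [NormedAddCommGroup F] [NormedSpace ℝ F]
    (φ : 𝓢(ℝ, F)) (s : ℝ) : ∃ A : ℝ≥0, 0 < A ∧ ∀ t, ‖φ t‖ ≤ A * (1 + (s - t) ^ 2)⁻¹ := by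
  obtain ⟨C₀, h₀, hC₀⟩ := φ.decay 0 0
  obtain ⟨C₂, h₂, hC₂⟩ := φ.decay 2 0
  refine ⟨((1 + 2 * s ^ 2) * C₀ + 2 * C₂).toNNReal, Real.toNNReal_pos.2 (by positivity),
    fun t => ?_⟩
  rw [Real.coe_toNNReal _ (by positivity)]
  have e₀ := hC₀ t
  have e₂ := hC₂ t
  simp only [pow_zero, one_mul, norm_iteratedFDeriv_zero, Real.norm_eq_abs, sq_abs] at e₀ e₂
  rw [← div_eq_mul_inv, le_div_iff₀ (by positivity)]
  have h1 : (s - t) ^ 2 ≤ 2 * s ^ 2 + 2 * t ^ 2 := by nlinarith [sq_nonneg (s + t)]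
  calc ‖φ t‖ * (1 + (s - t) ^ 2) ≤ ‖φ t‖ * (1 + (2 * s ^ 2 + 2 * t ^ 2)) := by gcongr
    _ = (1 + 2 * s ^ 2) * ‖φ t‖ + 2 * (t ^ 2 * ‖φ t‖) := by ring
    _ ≤ _ := by gcongr

/-- A function space on which the maximal operator is bounded consists of tempered functions. -/
theorem BanachFunctionSpace.lintegral_schwartz_mul_lt_top {Φ : BanachFunctionSpace}
    (hM : HardyLittlewoodBoundedOn Φ.norm) {f : ℝ → ℝ≥0∞} (hf : AEMeasurable f volume)
    (h : Φ.norm f < ∞) (φ : 𝓢(ℝ, ℂ)) : ∫⁻ t, ‖φ t‖ₑ * f t < ∞ := by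
  obtain ⟨s, hs⟩ := exists_hardyLittlewood_lt_top hM hf h
  obtain ⟨A, -, hA⟩ := φ.exists_norm_le_cauchyKernel s
  calc ∫⁻ t, ‖φ t‖ₑ * f t
      ≤ ∫⁻ t, ENNReal.ofReal A * (ENNReal.ofReal (1 * (1 + (1 * (s - t)) ^ 2)⁻¹) * f t) := by
        refine lintegral_mono fun t => ?_
        dsimp only
        rw [← mul_assoc, ← ENNReal.ofReal_mul A.coe_nonneg, ← ofReal_norm, one_mul, one_mul]
        gcongr
        exact hA t
    _ ≤ ENNReal.ofReal A * (16 * hardyLittlewood f s) := by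
        rw [lintegral_const_mul' _ _ ENNReal.ofReal_ne_top]
        gcongr
        exact lintegral_cauchyKernel_mul_le_hardyLittlewood hf one_pos s
    _ < ∞ := ENNReal.mul_lt_top ENNReal.ofReal_lt_top (ENNReal.mul_lt_top (by simp) hs)

/-! ### Cutting off Schwartz functions -/

section Cutoff

open Filter Topology

theorem IsDyadicGenerator.hasCompactSupport {ψ : ℝ → ℂ} (hψ : IsDyadicGenerator ψ) :
    HasCompactSupport ψ :=
  isCompact_Icc.of_isClosed_subset (isClosed_tsupport ψ) hψ.support

theorem contDiff_comp_mul {a : ℝ → ℂ} (ha : ContDiff ℝ (⊤ : ℕ∞) a) (c : ℝ) :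
    ContDiff ℝ (⊤ : ℕ∞) fun t => a (c * t) :=
  ha.comp (contDiff_const.mul contDiff_id)

theorem HasCompactSupport.comp_mul {a : ℝ → ℂ} (ha : HasCompactSupport a) {c : ℝ} (hc : c ≠ 0) :
    HasCompactSupport fun t => a (c * t) := by
  simpa using ha.comp_smul hc

theorem contDiff_comp_div {a : ℝ → ℂ} (ha : ContDiff ℝ (⊤ : ℕ∞) a) (c : ℝ) :
    ContDiff ℝ (⊤ : ℕ∞) fun t => a (t / c) :=
  ha.comp (contDiff_id.div_const c)

theorem HasCompactSupport.comp_div {a : ℝ → ℂ} (ha : HasCompactSupport a) {c : ℝ} (hc : c ≠ 0) :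
    HasCompactSupport fun t => a (t / c) := by
  simpa [div_eq_inv_mul] using ha.comp_smul (inv_ne_zero hc)

/-- The truncations of a Schwartz function by `χ(· / R)` converge to it in `𝓢` as `R → ∞`:
where `1 - χ(· / R)` does not vanish, one factor `|x| / R ≥ 1` is gained. -/
theorem SchwartzMap.tendsto_smulLeftCLM_dilate {χ : ℝ → ℂ} (hc : HasCompactSupport χ)
    (hs : ContDiff ℝ (⊤ : ℕ∞) χ) (h1 : ∀ t ∈ Icc (-1 : ℝ) 1, χ t = 1) (φ : 𝓢(ℝ, ℂ)) :
    Tendsto (fun n : ℕ => SchwartzMap.smulLeftCLM ℂ (fun t => χ (t / 2 ^ n)) φ) atTop (𝓝 φ) := by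
  rw [(schwartz_withSeminorms ℝ ℝ ℂ).tendsto_nhds _ φ]
  rintro ⟨k, N⟩ ε hε
  set η : ℝ → ℂ := fun t => χ t - 1 with hη
  have hηs : ContDiff ℝ (⊤ : ℕ∞) η := hs.sub contDiff_const
  have hB : ∀ i : ℕ, ∃ B : ℝ, 0 ≤ B ∧ ∀ x, ‖iteratedDeriv i η x‖ ≤ B := by
    intro i
    obtain ⟨B, hB0, hB⟩ := (hc.toSchwartzMap hs).decay 0 i
    refine ⟨B + 1, by positivity, fun x => ?_⟩
    have h0 : iteratedDeriv i η x = iteratedDeriv i χ x - iteratedDeriv i (fun _ => (1 : ℂ)) x :=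
      iteratedDeriv_fun_sub (hs.of_le (by exact_mod_cast le_top)).contDiffAt contDiffAt_const
    have h2 : ‖iteratedDeriv i (fun _ => (1 : ℂ)) x‖ ≤ 1 := by
      rw [iteratedDeriv_const]; split_ifs <;> simp
    have h3 : ‖iteratedDeriv i χ x‖ ≤ B := by
      have := hB x
      rwa [pow_zero, one_mul, norm_iteratedFDeriv_eq_norm_iteratedDeriv] at this
    rw [h0]
    exact (norm_sub_le _ _).trans (add_le_add h3 h2)
  choose B hB0 hB using hB
  set K : ℝ := ∑ i ∈ Finset.range (N + 1),
    (N.choose i : ℝ) * B i * SchwartzMap.seminorm ℝ (k + 1) (N - i) φ with hK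
  have hK0 : 0 ≤ K := Finset.sum_nonneg fun i _ =>
    mul_nonneg (mul_nonneg (by positivity) (hB0 i)) (apply_nonneg _ _)
  have hbound : ∀ n : ℕ, SchwartzMap.seminorm ℝ k N
      (SchwartzMap.smulLeftCLM ℂ (fun t => χ (t / 2 ^ n)) φ - φ) ≤ K * (1 / 2) ^ n := by
    intro n
    have hg : Function.HasTemperateGrowth fun t : ℝ => χ (t / 2 ^ n) :=
      (hc.comp_div (by positivity)).hasTemperateGrowth
        (contDiff_comp_div hs _)
    have hfun : ⇑(SchwartzMap.smulLeftCLM ℂ (fun t => χ (t / 2 ^ n)) φ - φ) =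
        fun x => η (((1 : ℝ) / 2) ^ n * x) * φ x := by
      ext x
      rw [sub_apply, SchwartzMap.smulLeftCLM_apply_apply hg, hη, one_div,
        inv_pow, ← div_eq_inv_mul]
      simp [sub_mul]
    refine SchwartzMap.seminorm_le_bound' ℝ k N _ (by positivity) fun x => ?_
    rw [hfun]
    have hηn : ContDiff ℝ (⊤ : ℕ∞) fun x : ℝ => η ((1 / 2) ^ n * x) :=
      hηs.comp (contDiff_const.mul contDiff_id)
    rcases lt_or_ge |x| (2 ^ n) with hx | hx
    · have h0 : (fun x => η (((1 : ℝ) / 2) ^ n * x) * φ x) =ᶠ[𝓝 x] fun _ => 0 := by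
        filter_upwards [continuous_abs.continuousAt.eventually (gt_mem_nhds hx)] with y hy
        have hy' : (1 / 2 : ℝ) ^ n * y ∈ Icc (-1 : ℝ) 1 := by
          rw [mem_Icc, ← abs_le, abs_mul, one_div, inv_pow, abs_of_pos (by positivity),
            inv_mul_le_iff₀ (by positivity), mul_one]
          exact hy.le
        have h2 : η ((1 / 2) ^ n * y) = χ ((1 / 2) ^ n * y) - 1 := rfl
        rw [h2, h1 _ hy', sub_self, zero_mul]
      rw [h0.iteratedDeriv_eq, iteratedDeriv_const]
      simp only [ite_self, norm_zero, mul_zero]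
      positivity
    · have hx1 : |x| ^ k ≤ (1 / 2) ^ n * |x| ^ (k + 1) := by
        rw [one_div, inv_pow, le_inv_mul_iff₀ (by positivity), pow_succ, mul_comm]
        gcongr
      have hL := norm_iteratedFDeriv_mul_le (n := N) hηn (φ.smooth ⊤) x (by exact_mod_cast le_top)
      simp only [norm_iteratedFDeriv_eq_norm_iteratedDeriv] at hL
      calc |x| ^ k * ‖iteratedDeriv N (fun x => η (((1 : ℝ) / 2) ^ n * x) * φ x) x‖
          ≤ ((1 / 2) ^ n * |x| ^ (k + 1)) * ∑ i ∈ Finset.range (N + 1), (N.choose i : ℝ) *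
            ‖iteratedDeriv i (fun x : ℝ => η ((1 / 2) ^ n * x)) x‖ *
              ‖iteratedDeriv (N - i) φ x‖ := by gcongr
        _ = (1 / 2) ^ n * ∑ i ∈ Finset.range (N + 1), (N.choose i : ℝ) *
            ‖iteratedDeriv i (fun x : ℝ => η ((1 / 2) ^ n * x)) x‖ *
              (|x| ^ (k + 1) * ‖iteratedDeriv (N - i) φ x‖) := by
            rw [mul_assoc, Finset.mul_sum]
            congr 1
            exact Finset.sum_congr rfl fun i _ => by ring
        _ ≤ (1 / 2) ^ n * K := by
            refine mul_le_mul_of_nonneg_left (Finset.sum_le_sum fun i _ => mul_le_mul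
              (mul_le_mul_of_nonneg_left ?_ (by positivity)) ?_ (by positivity)
              (mul_nonneg (by positivity) (hB0 i))) (by positivity)
            · rw [iteratedDeriv_comp_const_smul (hηs.of_le (by exact_mod_cast le_top)), norm_smul]
              refine (mul_le_of_le_one_left (norm_nonneg _) ?_).trans (hB i _)
              rw [norm_pow, norm_pow]
              exact pow_le_one₀ (by positivity) (pow_le_one₀ (norm_nonneg _) (by norm_num))
            · exact SchwartzMap.le_seminorm' ℝ _ _ φ x
        _ = K * (1 / 2) ^ n := mul_comm _ _
  have hlim : Tendsto (fun n : ℕ => K * (1 / 2 : ℝ) ^ n) atTop (𝓝 0) := by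
    simpa using (tendsto_pow_atTop_nhds_zero_of_lt_one (r := (1 / 2 : ℝ)) (by norm_num)
      (by norm_num)).const_mul K
  filter_upwards [hlim.eventually (gt_mem_nhds hε)] with n hn
  exact (hbound n).trans_lt hn

theorem IsDyadicGenerator.tendsto_smulLeftCLM {ψ : ℝ → ℂ} (hψ : IsDyadicGenerator ψ)
    (φ : 𝓢(ℝ, ℂ)) :
    Tendsto (fun n : ℕ => SchwartzMap.smulLeftCLM ℂ (fun t => ψ (t / 2 ^ n)) φ) atTop (𝓝 φ) :=
  φ.tendsto_smulLeftCLM_dilate hψ.hasCompactSupport hψ.smooth hψ.eq_one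

end Cutoff

/-! ### Regular distributions given by functions of finite norm -/

section Regular

open Filter Topology

theorem BanachFunctionSpace.integrable_schwartz_smul {Φ : BanachFunctionSpace}
    (hM : HardyLittlewoodBoundedOn Φ.norm) {g : ℝ → X} (hg : AEStronglyMeasurable g volume)
    (h : Φ.norm (fun t => ‖g t‖ₑ) < ∞) (φ : 𝓢(ℝ, ℂ)) : Integrable (fun t => φ t • g t) volume := by
  refine ⟨φ.continuous.aestronglyMeasurable.smul hg, ?_⟩
  simpa [HasFiniteIntegral, enorm_smul] using lintegral_schwartz_mul_lt_top hM hg.enorm h φ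

/-- If the density of a regular distribution has finite norm, then the integral formula extends
from compactly supported test functions to all Schwartz functions. -/
theorem IsRepresentedBy.apply_eq_integral {Φ : BanachFunctionSpace}
    (hM : HardyLittlewoodBoundedOn Φ.norm) {ψ : ℝ → ℂ} (hψ : IsDyadicGenerator ψ)
    {u : 𝓢'(ℝ, X)} {g : ℝ → X} (hu : IsRepresentedBy u g)
    (h : Φ.norm (fun t => ‖g t‖ₑ) < ∞) (φ : 𝓢(ℝ, ℂ)) : u φ = ∫ t, φ t • g t := by
  have hgm := hu.1.aestronglyMeasurable
  have hg : ∀ n : ℕ, Function.HasTemperateGrowth fun t : ℝ => ψ (t / 2 ^ n) := fun n =>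
    (hψ.hasCompactSupport.comp_div (by positivity)).hasTemperateGrowth
      (contDiff_comp_div hψ.smooth _)
  set φn : ℕ → 𝓢(ℝ, ℂ) := fun n => SchwartzMap.smulLeftCLM ℂ (fun t => ψ (t / 2 ^ n)) φ
  have hφn : ∀ n t, φn n t = ψ (t / 2 ^ n) * φ t := fun n t =>
    SchwartzMap.smulLeftCLM_apply_apply (hg n) φ t
  have h1 : Tendsto (fun n => u (φn n)) atTop (𝓝 (u φ)) :=
    (u.continuous.tendsto φ).comp (hψ.tendsto_smulLeftCLM φ)
  have h2 : ∀ n, u (φn n) = ∫ t, φn n t • g t := by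
    refine fun n => hu.2 _ ?_
    have hfun : ⇑(φn n) = (fun t => ψ (t / 2 ^ n)) * ⇑φ := funext (hφn n)
    rw [hfun]
    exact (hψ.hasCompactSupport.comp_div (by positivity)).mul_right
  obtain ⟨B, hB⟩ := hψ.hasCompactSupport.exists_bound_of_continuous hψ.smooth.continuous
  have h3 : Tendsto (fun n => ∫ t, φn n t • g t) atTop (𝓝 (∫ t, φ t • g t)) := by
    refine tendsto_integral_of_dominated_convergence (fun t => B * ‖φ t • g t‖)
      (fun n => (φn n).continuous.aestronglyMeasurable.smul hgm)
      ((BanachFunctionSpace.integrable_schwartz_smul hM hgm h φ).norm.const_mul B)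
      (fun n => .of_forall fun t => ?_) (.of_forall fun t => ?_)
    · rw [hφn, mul_smul, norm_smul]
      exact mul_le_mul_of_nonneg_right (hB _) (norm_nonneg _)
    · -- the truncations of `φ` eventually agree with `φ` at the point `t`
      obtain ⟨N, hN⟩ := pow_unbounded_of_one_lt |t| one_lt_two
      refine tendsto_const_nhds.congr' ?_
      filter_upwards [eventually_ge_atTop N] with n hn
      have hn' : |t| ≤ 2 ^ n := hN.le.trans (pow_le_pow_right₀ one_le_two hn)
      rw [hφn, hψ.eq_one, one_mul]
      rw [mem_Icc, ← abs_le, abs_div, abs_of_pos (a := (2 : ℝ) ^ n) (by positivity)]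
      exact div_le_one_of_le₀ hn' (by positivity)
  simp_rw [h2] at h1
  exact tendsto_nhds_unique h1 h3

end Regular

/-! ### Fourier multipliers as convolution operators -/

section Multiplier

open scoped FourierTransform

theorem SchwartzMap.fourierInv_comp_add (φ : 𝓢(ℝ, ℂ)) (x ξ : ℝ) :
    𝓕⁻ (SchwartzMap.compSubConstCLM ℂ (-x) φ) ξ = Real.fourierChar (-(ξ * x)) • 𝓕⁻ φ ξ := by
  simp only [SchwartzMap.fourierInv_coe, Real.fourierInv_eq, SchwartzMap.compSubConstCLM_apply,
    sub_neg_eq_add]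
  rw [Circle.smul_def, smul_eq_mul, ← integral_const_mul,
    ← integral_add_right_eq_self (fun v => (Real.fourierChar (-(ξ * x)) : ℂ) *
      (Real.fourierChar (inner ℝ v ξ) • φ v)) x]
  congr with v
  rw [Circle.smul_def, Circle.smul_def, smul_eq_mul, smul_eq_mul, ← mul_assoc, ← Circle.coe_mul,
    ← AddChar.map_add_eq_mul]
  congr 3
  simp
  ring

/-- The transpose of the Fourier multiplier with symbol `m` is the convolution with the reflected
kernel `𝓕⁻ m`. -/
theorem SchwartzMap.fourier_mul_fourierInv_apply {m : ℝ → ℂ} (hm : HasCompactSupport m)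
    (hms : ContDiff ℝ (⊤ : ℕ∞) m) (φ : 𝓢(ℝ, ℂ)) (x : ℝ) :
    𝓕 (SchwartzMap.smulLeftCLM ℂ m (𝓕⁻ φ)) x =
      ∫ y, φ y * 𝓕⁻ (hm.toSchwartzMap hms) (y - x) := by
  have hg := hm.hasTemperateGrowth hms
  calc 𝓕 (SchwartzMap.smulLeftCLM ℂ m (𝓕⁻ φ)) x
      = ∫ ξ, 𝓕⁻ (SchwartzMap.compSubConstCLM ℂ (-x) φ) ξ * hm.toSchwartzMap hms ξ := by
        rw [SchwartzMap.fourier_coe, Real.fourier_eq]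
        congr with ξ
        rw [SchwartzMap.fourierInv_comp_add, SchwartzMap.smulLeftCLM_apply_apply hg]
        simp [Circle.smul_def, mul_comm, mul_left_comm]
    _ = ∫ y, SchwartzMap.compSubConstCLM ℂ (-x) φ y * 𝓕⁻ (hm.toSchwartzMap hms) y :=
        SchwartzMap.integral_fourierInv_mul_eq _ _
    _ = _ := by
        rw [← integral_sub_right_eq_self _ x]
        simp

/-- The kernel of the dilated multiplier `m(· / l)` is the `L¹`-normalized dilate of the kernel
of `m`. -/
theorem SchwartzMap.exists_norm_fourierInv_dilate_le {m : ℝ → ℂ} (hm : HasCompactSupport m)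
    (hms : ContDiff ℝ (⊤ : ℕ∞) m) : ∃ A : ℝ≥0, 0 < A ∧ ∀ l : ℝ, 0 < l → ∀ t,
      ‖𝓕⁻ (fun ξ => m (ξ / l)) t‖ ≤ A * (l * (1 + (l * t) ^ 2)⁻¹) := by
  obtain ⟨A, hA, h⟩ := (𝓕⁻ (hm.toSchwartzMap hms)).exists_norm_le_cauchyKernel 0
  refine ⟨A, hA, fun l hl t => ?_⟩
  have hk : 𝓕⁻ (fun ξ => m (ξ / l)) t = l • 𝓕⁻ (hm.toSchwartzMap hms) (l * t) := by
    rw [SchwartzMap.fourierInv_coe, Real.fourierInv_eq, Real.fourierInv_eq]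
    have := Measure.integral_comp_div
      (fun ξ => Real.fourierChar (inner ℝ ξ (l * t)) • hm.toSchwartzMap hms ξ) l
    rw [abs_of_pos hl] at this
    rw [← this]
    congr with ξ
    have : ξ / l * (l * t) = ξ * t := by field_simp
    simp [this, mul_comm]
  rw [hk, norm_smul, Real.norm_of_nonneg hl.le]
  calc l * ‖𝓕⁻ (hm.toSchwartzMap hms) (l * t)‖ ≤ l * (A * (1 + (0 - l * t) ^ 2)⁻¹) := by
        gcongr; exact h _
    _ = _ := by rw [zero_sub, neg_sq]; ring

/-- On a regular distribution with density `g` of finite norm, the multiplier acts as convolution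
of `g` with the kernel `𝓕⁻ m`, which is bounded pointwise by the maximal function of `‖g‖`. The
constant `16` is that of the pointwise bound, `A` that of the decay of the kernel, and `C` bounds
the maximal operator. -/
theorem BanachFunctionSpace.distNorm_fourierMultiplier_le [CompleteSpace X]
    {Φ : BanachFunctionSpace} {C : ℝ≥0} (hC : ∀ f : ℝ → ℝ≥0∞, AEMeasurable f volume → Φ.norm f < ∞ →
      Φ.norm (hardyLittlewood f) ≤ C * Φ.norm f)
    {ψ : ℝ → ℂ} (hψ : IsDyadicGenerator ψ) {m : ℝ → ℂ} (hm : HasCompactSupport m)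
    (hms : ContDiff ℝ (⊤ : ℕ∞) m) {A : ℝ≥0} {l : ℝ} (hl : 0 < l)
    (hA : ∀ t, ‖𝓕⁻ m t‖ ≤ A * (l * (1 + (l * t) ^ 2)⁻¹)) {u : 𝓢'(ℝ, X)} {g : ℝ → X}
    (hu : IsRepresentedBy u g) (h : Φ.norm (fun t => ‖g t‖ₑ) < ∞) :
    Φ.distNorm (TemperedDistribution.fourierMultiplierCLM X m u) ≤
      16 * A * C * Φ.norm (fun t => ‖g t‖ₑ) := by
  have hM : HardyLittlewoodBoundedOn Φ.norm := ⟨C, hC⟩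
  have hgm := hu.1.aestronglyMeasurable
  set k : 𝓢(ℝ, ℂ) := 𝓕⁻ (hm.toSchwartzMap hms) with hkdef
  have hk : ∀ t, ‖k t‖ ≤ A * (l * (1 + (l * t) ^ 2)⁻¹)  := fun t => by
    rw [hkdef, SchwartzMap.fourierInv_coe]; exact hA t
  set Mg := hardyLittlewood fun t => ‖g t‖ₑ with hMg
  have hMgm : AEMeasurable Mg volume :=
    (lowerSemicontinuous_hardyLittlewood _).measurable.aemeasurable
  set G : ℝ → X := fun y => ∫ x, k (y - x) • g x with hG
  have hkg : AEStronglyMeasurable (fun p : ℝ × ℝ => k (p.1 - p.2) • g p.2)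
      (volume.prod volume) :=
    (k.continuous.comp (continuous_fst.sub continuous_snd)).aestronglyMeasurable.smul hgm.comp_snd
  have hGm : AEStronglyMeasurable G volume := hkg.integral_prod_right'
  have hpt : ∀ y, ∫⁻ x, ‖k (y - x)‖ₑ * ‖g x‖ₑ ≤ 16 * A * Mg y := by
    intro y
    calc ∫⁻ x, ‖k (y - x)‖ₑ * ‖g x‖ₑ
        ≤ ∫⁻ x, A * (ENNReal.ofReal (l * (1 + (l * (y - x)) ^ 2)⁻¹) * ‖g x‖ₑ) := by
          refine lintegral_mono fun x => ?_
          dsimp only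
          rw [← mul_assoc, ← ENNReal.ofReal_coe_nnreal, ← ENNReal.ofReal_mul A.coe_nonneg,
            ← ofReal_norm]
          gcongr
          exact hk _
      _ ≤ A * (16 * Mg y) := by
          rw [lintegral_const_mul' _ _ ENNReal.coe_ne_top]
          gcongr
          exact lintegral_cauchyKernel_mul_le_hardyLittlewood hgm.enorm hl y
      _ = _ := by ring
  have hGle : ∀ y, ‖G y‖ₑ ≤ 16 * A * Mg y := fun y => by
    refine (enorm_integral_le_lintegral_enorm _).trans ?_
    simpa only [enorm_smul] using hpt y
  have hGnorm : Φ.norm (fun t => ‖G t‖ₑ) ≤ 16 * A * C * Φ.norm (fun t => ‖g t‖ₑ) := by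
    calc Φ.norm (fun t => ‖G t‖ₑ) ≤ Φ.norm (fun t => ((16 * A : ℝ≥0) : ℝ≥0∞) * Mg t) := by
          refine Φ.mono _ _ hGm.enorm (hMgm.const_mul _) (.of_forall fun t => ?_)
          simpa using hGle t
      _ = ((16 * A : ℝ≥0) : ℝ≥0∞) * Φ.norm Mg := Φ.norm_smul _ _ hMgm
      _ ≤ ((16 * A : ℝ≥0) : ℝ≥0∞) * (C * Φ.norm (fun t => ‖g t‖ₑ)) := by
          gcongr; exact hC _ hgm.enorm h
      _ = _ := by push_cast; ring
  have hMgfin : Φ.norm Mg < ∞ :=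
    (hC _ hgm.enorm h).trans_lt (ENNReal.mul_lt_top ENNReal.coe_lt_top h)
  have hGfin : Φ.norm (fun t => ‖G t‖ₑ) < ∞ :=
    hGnorm.trans_lt (ENNReal.mul_lt_top (by finiteness) h)
  refine (iInf₂_le G ⟨locallyIntegrable_of_norm_lt_top hM hGm hGfin, fun φ _ => ?_⟩).trans hGnorm
  have hint : Integrable (Function.uncurry fun y x => φ y • k (y - x) • g x)
      (volume.prod volume) := by
    have hmeas : AEStronglyMeasurable (Function.uncurry fun y x => φ y • k (y - x) • g x)
        (volume.prod volume) :=
      (φ.continuous.comp continuous_fst).aestronglyMeasurable.smul hkg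
    refine ⟨hmeas, ?_⟩
    rw [HasFiniteIntegral, lintegral_prod _ hmeas.enorm]
    calc _ ≤ ∫⁻ y, (16 * A) * (‖φ y‖ₑ * Mg y) := by
          refine lintegral_mono fun y => ?_
          simp only [Function.uncurry_apply_pair, enorm_smul]
          rw [lintegral_const_mul' _ _ enorm_ne_top, mul_left_comm]
          gcongr
          exact hpt y
      _ < ∞ := by
          rw [lintegral_const_mul' _ _ (by finiteness)]
          exact ENNReal.mul_lt_top (by finiteness) (lintegral_schwartz_mul_lt_top hM hMgm hMgfin φ)
  rw [TemperedDistribution.fourierMultiplierCLM_apply_apply, hu.apply_eq_integral hM hψ h]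
  calc ∫ x, 𝓕 (SchwartzMap.smulLeftCLM ℂ m (𝓕⁻ φ)) x • g x
      = ∫ x, ∫ y, φ y • k (y - x) • g x := by
        congr with x
        rw [SchwartzMap.fourier_mul_fourierInv_apply hm hms, ← integral_smul_const]
        simp only [mul_smul, hkdef]
    _ = ∫ y, ∫ x, φ y • k (y - x) • g x := (integral_integral_swap hint).symm
    _ = ∫ y, φ y • G y := by simp only [integral_smul, hG]

/-- The multiplier theorem for dyadic dilates: the operators `m(D / l)`, `l > 0`, are uniformly
bounded on `Φ(X)`. -/
theorem BanachFunctionSpace.exists_distNorm_symbolD_dilate_le [CompleteSpace X]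
    {Φ : BanachFunctionSpace} (hM : HardyLittlewoodBoundedOn Φ.norm)
    {ψ : ℝ → ℂ} (hψ : IsDyadicGenerator ψ) {m : ℝ → ℂ}
    (hm : HasCompactSupport m) (hms : ContDiff ℝ (⊤ : ℕ∞) m) :
    ∃ K : ℝ≥0, ∀ l : ℝ, 0 < l → ∀ u : 𝓢'(ℝ, X),
      Φ.distNorm (symbolD (fun ξ => m (ξ / l)) u) ≤ K * Φ.distNorm u := by
  obtain ⟨C, hC⟩ := hM
  have hm' : HasCompactSupport fun ξ => m (2 * Real.pi * ξ) := hm.comp_mul (by positivity)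
  have hms' : ContDiff ℝ (⊤ : ℕ∞) fun ξ => m (2 * Real.pi * ξ) :=
    contDiff_comp_mul hms _
  obtain ⟨A, hA0, hA⟩ := SchwartzMap.exists_norm_fourierInv_dilate_le hm' hms'
  refine ⟨16 * A * (C + 1), fun l hl u => ?_⟩
  -- adding `1` to `C` makes the constant positive, so that the bound is trivial at `∞`
  have hK : ((16 * A * (C + 1) : ℝ≥0) : ℝ≥0∞) ≠ 0 := by
    have : 0 < 16 * A * (C + 1) := by positivity
    exact_mod_cast this.ne'
  rw [distNorm, distNorm, ENNReal.mul_iInf_of_ne hK ENNReal.coe_ne_top]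
  refine le_iInf fun g => ?_
  rw [ENNReal.mul_iInf_of_ne hK ENNReal.coe_ne_top]
  refine le_iInf fun hu => ?_
  rcases eq_or_ne (Φ.norm fun t => ‖g t‖ₑ) ∞ with h | h
  · rw [h, ENNReal.mul_top hK]; exact le_top
  · have hsym : (fun ξ => m (2 * Real.pi * ξ / l)) = fun ξ => m (2 * Real.pi * (ξ / l)) := by
      ext ξ; rw [mul_div_assoc]
    refine (distNorm_fourierMultiplier_le hC hψ (m := fun ξ => m (2 * Real.pi * ξ / l)) ?_ ?_ hl
      (A := A) ?_ hu h.lt_top).trans ?_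
    · rw [hsym]; exact hm'.comp_div hl.ne'
    · rw [hsym]; exact contDiff_comp_div hms' l
    · rw [hsym]; exact hA l hl
    · push_cast
      gcongr
      exact le_self_add

end Multiplier

/-! ### The norm of `Φ(X)` on distributions -/

section DistNorm

variable {u v : 𝓢'(ℝ, X)} {g h : ℝ → X}

theorem IsRepresentedBy.integrable (hu : IsRepresentedBy u g) {φ : 𝓢(ℝ, ℂ)}
    (hφ : HasCompactSupport φ) : Integrable (fun t => φ t • g t) volume :=
  hu.1.integrable_smul_left_of_hasCompactSupport φ.continuous hφ

theorem IsRepresentedBy.add (hu : IsRepresentedBy u g) (hv : IsRepresentedBy v h) :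
    IsRepresentedBy (u + v) fun t => g t + h t := by
  refine ⟨hu.1.add hv.1, fun φ hφ => ?_⟩
  simp only [smul_add]
  rw [integral_add (hu.integrable hφ) (hv.integrable hφ), ← hu.2 φ hφ, ← hv.2 φ hφ]
  rfl

theorem IsRepresentedBy.const_smul (hu : IsRepresentedBy u g) (c : ℂ) :
    IsRepresentedBy (c • u) fun t => c • g t := by
  refine ⟨hu.1.smul c, fun φ hφ => ?_⟩
  simp only [smul_comm _ c]
  rw [integral_smul, ← hu.2 φ hφ]
  rfl

theorem isRepresentedBy_zero : IsRepresentedBy (0 : 𝓢'(ℝ, X)) 0 :=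
  ⟨locallyIntegrable_zero, fun φ _ => by simp⟩

theorem IsRepresentedBy.ae_eq [CompleteSpace X] (hg : IsRepresentedBy u g)
    (hh : IsRepresentedBy u h) : g =ᵐ[volume] h := by
  refine ae_eq_of_integral_contDiff_smul_eq hg.1 hh.1 fun η hη hηc => ?_
  have hc : HasCompactSupport fun t => (η t : ℂ) := hηc.comp_left Complex.ofReal_zero
  have hs : ContDiff ℝ (⊤ : ℕ∞) fun t => (η t : ℂ) := Complex.ofRealCLM.contDiff.comp hη
  have := (hg.2 (hc.toSchwartzMap hs) hc).symm.trans (hh.2 (hc.toSchwartzMap hs) hc)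
  simpa using this

namespace BanachFunctionSpace

variable (Φ : BanachFunctionSpace)

theorem norm_zero : Φ.norm (fun _ => 0) = 0 :=
  (Φ.norm_eq_zero_iff _ aemeasurable_const).2 (.of_forall fun _ => rfl)

theorem distNorm_zero : Φ.distNorm (0 : 𝓢'(ℝ, X)) = 0 := by
  refine le_antisymm ((iInf₂_le 0 isRepresentedBy_zero).trans ?_) zero_le
  simp [Φ.norm_zero]

theorem distNorm_add_le (u v : 𝓢'(ℝ, X)) :
    Φ.distNorm (u + v) ≤ Φ.distNorm u + Φ.distNorm v := by
  unfold distNorm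
  rw [ENNReal.iInf_add]
  refine le_iInf fun g => ?_
  rw [ENNReal.iInf_add]
  refine le_iInf fun hg => ?_
  rw [ENNReal.add_iInf]
  refine le_iInf fun h => ?_
  rw [ENNReal.add_iInf]
  refine le_iInf fun hh => (iInf₂_le _ (hg.add hh)).trans ?_
  have hgm := hg.1.aestronglyMeasurable
  have hhm := hh.1.aestronglyMeasurable
  exact (Φ.mono _ _ (hgm.add hhm).enorm (hgm.enorm.add hhm.enorm)
    (.of_forall fun t => enorm_add_le _ _)).trans (Φ.norm_add_le _ _ hgm.enorm hhm.enorm)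

theorem distNorm_smul_le {c : ℂ} (hc : c ≠ 0) (u : 𝓢'(ℝ, X)) :
    Φ.distNorm (c • u) ≤ ‖c‖ₑ * Φ.distNorm u := by
  unfold distNorm
  rw [ENNReal.mul_iInf_of_ne (by simpa using hc) enorm_ne_top]
  refine le_iInf fun g => ?_
  rw [ENNReal.mul_iInf_of_ne (by simpa using hc) enorm_ne_top]
  refine le_iInf fun hg => (iInf₂_le _ (hg.const_smul c)).trans ?_
  simp only [enorm_smul]
  exact (Φ.norm_smul ‖c‖₊ _ hg.1.aestronglyMeasurable.enorm).le

theorem distNorm_smul (c : ℂ) (u : 𝓢'(ℝ, X)) : Φ.distNorm (c • u) = ‖c‖ₑ * Φ.distNorm u := by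
  rcases eq_or_ne c 0 with rfl | hc
  · simp [Φ.distNorm_zero]
  refine le_antisymm (Φ.distNorm_smul_le hc u) ?_
  have h := Φ.distNorm_smul_le (inv_ne_zero hc) (c • u)
  rw [inv_smul_smul₀ hc, enorm_inv hc, mul_comm, ← div_eq_mul_inv] at h
  rw [mul_comm]
  exact (ENNReal.le_div_iff_mul_le (.inl (by simpa using hc)) (.inl enorm_ne_top)).1 h

theorem apply_eq_zero_of_distNorm_eq_zero [CompleteSpace X] (h : Φ.distNorm u = 0)
    {φ : 𝓢(ℝ, ℂ)} (hφ : HasCompactSupport φ) : u φ = 0 := by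
  have hex : ∃ g, IsRepresentedBy u g := by
    by_contra! hne
    simp [distNorm, hne] at h
  obtain ⟨g, hg⟩ := hex
  have hnorm : Φ.norm (fun t => ‖g t‖ₑ) ≤ Φ.distNorm u := by
    refine le_iInf₂ fun g' hg' => Φ.mono _ _ hg.1.aestronglyMeasurable.enorm
      hg'.1.aestronglyMeasurable.enorm ?_
    filter_upwards [hg.ae_eq hg'] with t ht
    rw [ht]
  have h0 := (Φ.norm_eq_zero_iff _ hg.1.aestronglyMeasurable.enorm).1
    (le_antisymm (hnorm.trans h.le) zero_le)
  rw [hg.2 φ hφ]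
  refine integral_eq_zero_of_ae ?_
  filter_upwards [h0] with t ht
  have : g t = 0 := by simpa using ht
  simp [this]

theorem eq_zero_of_distNorm_eq_zero [CompleteSpace X] {ψ : ℝ → ℂ} (hψ : IsDyadicGenerator ψ)
    (h : Φ.distNorm u = 0) : u = 0 := by
  ext φ
  refine tendsto_nhds_unique ((u.continuous.tendsto φ).comp (hψ.tendsto_smulLeftCLM φ)) ?_
  refine tendsto_const_nhds.congr fun n => (Φ.apply_eq_zero_of_distNorm_eq_zero h ?_).symm
  have hc : HasCompactSupport fun t : ℝ => ψ (t / 2 ^ n) :=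
    hψ.hasCompactSupport.comp_div (by positivity)
  rw [SchwartzMap.smulLeftCLM_apply (hc.hasTemperateGrowth (contDiff_comp_div hψ.smooth _))]
  exact hc.smul_right

end BanachFunctionSpace

end DistNorm

/-! ### Symbol calculus -/

section SymbolCalculus

open Filter Topology
open scoped FourierTransform LineDeriv

theorem Function.HasTemperateGrowth.comp_two_pi_mul {a : ℝ → ℂ}
    (ha : Function.HasTemperateGrowth a) :
    Function.HasTemperateGrowth fun ξ : ℝ => a (2 * Real.pi * ξ) :=
  ha.comp (g := a) (f := fun ξ : ℝ => 2 * Real.pi * ξ) (by fun_prop)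

theorem symbolD_symbolD {a b : ℝ → ℂ} (ha : Function.HasTemperateGrowth a)
    (hb : Function.HasTemperateGrowth b) (u : 𝓢'(ℝ, X)) :
    symbolD a (symbolD b u) = symbolD (fun ξ => a ξ * b ξ) u := by
  unfold symbolD
  rw [TemperedDistribution.fourierMultiplierCLM_fourierMultiplierCLM_apply hb.comp_two_pi_mul
    ha.comp_two_pi_mul, mul_comm]
  rfl

theorem symbolD_const_mul {a : ℝ → ℂ} (ha : Function.HasTemperateGrowth a) (c : ℂ)
    (u : 𝓢'(ℝ, X)) : symbolD (fun ξ => c * a ξ) u = c • symbolD a u := by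
  unfold symbolD
  exact congr($(TemperedDistribution.fourierMultiplierCLM_smul (F := X) ha.comp_two_pi_mul c) u)

theorem symbolD_sub {a b : ℝ → ℂ} (ha : Function.HasTemperateGrowth a)
    (hb : Function.HasTemperateGrowth b) (u : 𝓢'(ℝ, X)) :
    symbolD (fun ξ => a ξ - b ξ) u = symbolD a u - symbolD b u := by
  unfold symbolD
  rw [TemperedDistribution.fourierMultiplierCLM_apply,
    TemperedDistribution.fourierMultiplierCLM_apply,
    TemperedDistribution.fourierMultiplierCLM_apply, sub_eq_add_neg, ← neg_one_smul ℂ,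
    ← FourierTransform.fourierInv_smul, ← FourierTransform.fourierInv_add]
  have := TemperedDistribution.smulLeftCLM_sub (F := X) ha.comp_two_pi_mul hb.comp_two_pi_mul
  rw [neg_one_smul, ← sub_eq_add_neg]
  congr 1
  exact congr($this (𝓕 u))

theorem derivCLM_eq_symbolD (u : 𝓢'(ℝ, X)) :
    TemperedDistribution.derivCLM X u = symbolD (fun ξ : ℝ => Complex.I * ξ) u := by
  have h1 : TemperedDistribution.derivCLM X u = ∂_{(1 : ℝ)} u := by
    ext φ
    rw [TemperedDistribution.derivCLM_apply_apply, TemperedDistribution.lineDerivOp_apply_apply]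
    congr 2
  rw [h1, TemperedDistribution.lineDeriv_eq_fourierMultiplierCLM, symbolD]
  have h2 : (fun ξ : ℝ => Complex.I * ((2 * Real.pi * ξ : ℝ) : ℂ)) =
      (2 * Real.pi * Complex.I) • fun ξ : ℝ => (ξ : ℂ) := by
    ext ξ
    simp only [Pi.smul_apply, smul_eq_mul]
    push_cast
    ring
  rw [h2, TemperedDistribution.fourierMultiplierCLM_smul (by fun_prop)]
  simp

theorem hasTemperateGrowth_I_mul :
    Function.HasTemperateGrowth fun ξ : ℝ => Complex.I * (ξ : ℂ) := by
  fun_prop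

/-! ### The dyadic resolution of the identity -/

variable {ψ : ℝ → ℂ}

namespace IsDyadicGenerator

theorem hasTemperateGrowth_dilate (hψ : IsDyadicGenerator ψ) (n : ℕ) :
    Function.HasTemperateGrowth fun t => ψ (t / 2 ^ n) :=
  (hψ.hasCompactSupport.comp_div (by positivity)).hasTemperateGrowth
    (contDiff_comp_div hψ.smooth _)

theorem hasTemperateGrowth_dyadicPiece (hψ : IsDyadicGenerator ψ) (j : ℕ) :
    Function.HasTemperateGrowth (dyadicPiece ψ j) := by
  cases j with
  | zero => exact hψ.hasCompactSupport.hasTemperateGrowth hψ.smooth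
  | succ j => exact (hψ.hasTemperateGrowth_dilate (j + 1)).sub (hψ.hasTemperateGrowth_dilate j)

/-- The dyadic pieces determine a tempered distribution: they telescope to the operators
`ψ(2⁻ⁿ D)`, which converge to the identity. -/
theorem eq_zero_of_symbolD_dyadicPiece (hψ : IsDyadicGenerator ψ) {u : 𝓢'(ℝ, X)}
    (h : ∀ j, symbolD (dyadicPiece ψ j) u = 0) : u = 0 := by
  have hn : ∀ n : ℕ, symbolD (fun t => ψ (t / 2 ^ n)) u = 0 := by
    intro n
    induction n with
    | zero => simpa [dyadicPiece] using h 0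
    | succ n ih =>
      have := h (n + 1)
      rw [dyadicPiece, symbolD_sub (hψ.hasTemperateGrowth_dilate (n + 1))
        (hψ.hasTemperateGrowth_dilate n), ih, sub_zero] at this
      exact this
  -- the normalization of the transform dilates `ψ` by `2π`; the shift of the index by `3` makes
  -- the resulting cut-off functions equal to `1` on `[-1, 1]`, since `2π ≤ 8`
  obtain ⟨χ, hχ⟩ : ∃ χ : ℝ → ℂ, χ = fun t => ψ (2 * Real.pi / 2 ^ 3 * t) := ⟨_, rfl⟩
  have hχc : HasCompactSupport χ := hχ ▸ hψ.hasCompactSupport.comp_mul (by positivity)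
  have hχs : ContDiff ℝ (⊤ : ℕ∞) χ := hχ ▸ contDiff_comp_mul hψ.smooth _
  have hχ1 : ∀ t ∈ Icc (-1 : ℝ) 1, χ t = 1 := by
    intro t ht
    rw [hχ]
    refine hψ.eq_one _ ?_
    have hpi : 2 * Real.pi / 2 ^ 3 ≤ 1 := by linarith [Real.pi_le_four]
    rw [mem_Icc, ← abs_le] at ht ⊢
    rw [abs_mul, abs_of_pos (a := 2 * Real.pi / 2 ^ 3) (by positivity)]
    exact mul_le_one₀ hpi (abs_nonneg t) ht
  ext φ
  have hlim := (𝓕⁻ φ).tendsto_smulLeftCLM_dilate hχc hχs hχ1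
  have hlim' : Tendsto (fun n : ℕ => u (𝓕 (SchwartzMap.smulLeftCLM ℂ (fun t => χ (t / 2 ^ n))
      (𝓕⁻ φ)))) atTop (𝓝 (u φ)) := by
    have hF := (FourierTransform.continuous_fourier (E := 𝓢(ℝ, ℂ)) (F := 𝓢(ℝ, ℂ))).tendsto (𝓕⁻ φ)
    rw [FourierTransform.fourier_fourierInv_eq] at hF
    exact (u.continuous.tendsto φ).comp (hF.comp hlim)
  refine tendsto_nhds_unique hlim' (tendsto_const_nhds.congr fun n => ?_)
  have hz : symbolD (fun t => ψ (t / 2 ^ (n + 3))) u φ = 0 := by rw [hn]; rfl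
  have hsym : (fun t : ℝ => χ (t / 2 ^ n)) = fun t => ψ (2 * Real.pi * t / 2 ^ (n + 3)) := by
    ext t
    rw [hχ]
    rw [pow_add]
    field_simp
  rw [hsym]
  exact hz.symm

/-- `ψ(· / 4) - ψ(2 ·)`: a fattened version of the first annular piece. It is `1` where that
piece does not vanish, and it vanishes near the origin. -/
noncomputable def fattenedPiece (ψ : ℝ → ℂ) (t : ℝ) : ℂ := ψ (t / 4) - ψ (t / (1 / 2))

theorem contDiff_fattenedPiece (hψ : IsDyadicGenerator ψ) :
    ContDiff ℝ (⊤ : ℕ∞) (fattenedPiece ψ) :=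
  (contDiff_comp_div hψ.smooth 4).sub (contDiff_comp_div hψ.smooth (1 / 2))

theorem hasCompactSupport_fattenedPiece (hψ : IsDyadicGenerator ψ) :
    HasCompactSupport (fattenedPiece ψ) :=
  (hψ.hasCompactSupport.comp_div (by norm_num)).sub (hψ.hasCompactSupport.comp_div (by norm_num))

theorem eq_zero_of_two_le (hψ : IsDyadicGenerator ψ) {t : ℝ} (ht : 2 ≤ |t|) : ψ t = 0 := by
  by_contra hne
  -- the set where `ψ` does not vanish is open, hence contained in the interior `(-2, 2)`
  have hopen : IsOpen {x | ψ x ≠ 0} := isOpen_ne_fun hψ.smooth.continuous continuous_const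
  have hsub : {x | ψ x ≠ 0} ⊆ Icc (-2 : ℝ) 2 := (subset_tsupport ψ).trans hψ.support
  have := interior_maximal hsub hopen hne
  rw [interior_Icc] at this
  exact ht.not_gt (abs_lt.2 this)

theorem dyadicPiece_succ_mul_fattenedPiece (hψ : IsDyadicGenerator ψ) (j : ℕ) (ξ : ℝ) :
    fattenedPiece ψ (ξ / 2 ^ j) * dyadicPiece ψ (j + 1) ξ = dyadicPiece ψ (j + 1) ξ := by
  have hξ : ξ / 2 ^ (j + 1) = ξ / 2 ^ j / 2 := by rw [pow_succ, div_div]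
  simp only [dyadicPiece, hξ]
  set t := ξ / 2 ^ j
  rcases le_or_gt |t| 1 with h | h
  · rw [hψ.eq_one t (abs_le.1 h), hψ.eq_one (t / 2), sub_self, mul_zero]
    rw [mem_Icc, ← abs_le, abs_div, abs_two]; linarith
  rcases le_or_gt |t| 4 with h4 | h4
  · rw [fattenedPiece, hψ.eq_one (t / 4), hψ.eq_zero_of_two_le (t := t / (1 / 2)), sub_zero,
      one_mul]
    · rw [div_div_eq_mul_div, div_one, abs_mul, abs_two]; linarith
    · rw [mem_Icc, ← abs_le, abs_div, abs_of_pos (a := (4 : ℝ)) (by norm_num)]; linarith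
  · rw [hψ.eq_zero_of_two_le (t := t / 2), hψ.eq_zero_of_two_le (t := t), sub_self, mul_zero]
    · linarith
    · rw [abs_div, abs_two]; linarith

theorem dilate_mul_self (hψ : IsDyadicGenerator ψ) (ξ : ℝ) : ψ (ξ / 2) * ψ ξ = ψ ξ := by
  rcases le_or_gt 2 |ξ| with h | h
  · rw [hψ.eq_zero_of_two_le h, mul_zero]
  · rw [hψ.eq_one (ξ / 2), one_mul]
    rw [mem_Icc, ← abs_le, abs_div, abs_two]; linarith

theorem fattenedPiece_eq_zero (hψ : IsDyadicGenerator ψ) {t : ℝ} (ht : |t| ≤ 1 / 2) :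
    fattenedPiece ψ t = 0 := by
  rw [fattenedPiece, hψ.eq_one (t / 4), hψ.eq_one (t / (1 / 2)), sub_self]
  · rw [mem_Icc, ← abs_le, div_div_eq_mul_div, div_one, abs_mul, abs_two]; linarith
  · rw [mem_Icc, ← abs_le, abs_div, abs_of_pos (a := (4 : ℝ)) (by norm_num)]; linarith

theorem contDiff_fattenedPiece_div (hψ : IsDyadicGenerator ψ) :
    ContDiff ℝ (⊤ : ℕ∞) fun t : ℝ => fattenedPiece ψ t / (Complex.I * t) := by
  rw [contDiff_iff_contDiffAt]
  intro t
  rcases eq_or_ne t 0 with rfl | ht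
  · have hev : (fun t : ℝ => fattenedPiece ψ t / (Complex.I * t)) =ᶠ[𝓝 0] fun _ => 0 := by
      have h0 : ∀ᶠ t : ℝ in 𝓝 0, |t| < 1 / 2 :=
        continuous_abs.continuousAt.eventually (gt_mem_nhds (by norm_num))
      filter_upwards [h0] with t ht
      rw [hψ.fattenedPiece_eq_zero ht.le, zero_div]
    exact contDiffAt_const.congr_of_eventuallyEq hev
  · simp only [div_eq_mul_inv]
    exact hψ.contDiff_fattenedPiece.contDiffAt.mul ((contDiffAt_const.mul
      Complex.ofRealCLM.contDiff.contDiffAt).inv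
        (mul_ne_zero Complex.I_ne_zero (Complex.ofReal_ne_zero.2 ht)))

theorem hasCompactSupport_fattenedPiece_div (hψ : IsDyadicGenerator ψ) :
    HasCompactSupport fun t : ℝ => fattenedPiece ψ t / (Complex.I * t) := by
  simp only [div_eq_mul_inv]
  exact hψ.hasCompactSupport_fattenedPiece.mul_right

/-- The derivative on the `j`-th frequency piece is bounded by a multiple of `2 ^ j`. -/
theorem exists_distNorm_symbolD_derivCLM_le [CompleteSpace X] (hψ : IsDyadicGenerator ψ)
    {Φ : BanachFunctionSpace} (hM : HardyLittlewoodBoundedOn Φ.norm) :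
    ∃ K : ℝ≥0, ∀ (j : ℕ) (u : 𝓢'(ℝ, X)),
      Φ.distNorm (symbolD (dyadicPiece ψ j) (TemperedDistribution.derivCLM X u)) ≤
        K * ENNReal.ofReal (2 ^ j) * Φ.distNorm (symbolD (dyadicPiece ψ j) u) := by
  have hI : ContDiff ℝ (⊤ : ℕ∞) fun ξ : ℝ => Complex.I * (ξ : ℂ) :=
    hasTemperateGrowth_I_mul.1
  have hc₀ : HasCompactSupport fun ξ : ℝ => ψ (ξ / 2) * (Complex.I * ξ) :=
    (hψ.hasCompactSupport.comp_div (by norm_num)).mul_right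
  have hs₀ : ContDiff ℝ (⊤ : ℕ∞) fun ξ : ℝ => ψ (ξ / 2) * (Complex.I * ξ) :=
    (contDiff_comp_div hψ.smooth 2).mul hI
  have hc₁ : HasCompactSupport fun ξ : ℝ => fattenedPiece ψ ξ * (Complex.I * ξ) :=
    hψ.hasCompactSupport_fattenedPiece.mul_right
  have hs₁ : ContDiff ℝ (⊤ : ℕ∞) fun ξ : ℝ => fattenedPiece ψ ξ * (Complex.I * ξ) :=
    hψ.contDiff_fattenedPiece.mul hI
  obtain ⟨K₀, hK₀⟩ := Φ.exists_distNorm_symbolD_dilate_le (X := X) hM hψ hc₀ hs₀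
  obtain ⟨K₁, hK₁⟩ := Φ.exists_distNorm_symbolD_dilate_le (X := X) hM hψ hc₁ hs₁
  refine ⟨max K₀ K₁, fun j u => ?_⟩
  rw [derivCLM_eq_symbolD, symbolD_symbolD (hψ.hasTemperateGrowth_dyadicPiece j)
    hasTemperateGrowth_I_mul]
  cases j with
  | zero =>
    have hfac : (fun ξ : ℝ => dyadicPiece ψ 0 ξ * (Complex.I * ξ)) =
        fun ξ => ψ (ξ / 1 / 2) * (Complex.I * ((ξ / 1 : ℝ) : ℂ)) * dyadicPiece ψ 0 ξ := by
      ext ξ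
      simp only [dyadicPiece, div_one]
      nth_rw 1 [← hψ.dilate_mul_self ξ]
      ring
    rw [hfac, ← symbolD_symbolD _ (hψ.hasTemperateGrowth_dyadicPiece 0)]
    · refine (hK₀ 1 one_pos _).trans ?_
      rw [pow_zero, ENNReal.ofReal_one, mul_one]
      gcongr
      exact le_max_left _ _
    · simpa using hc₀.hasTemperateGrowth hs₀
  | succ j =>
    have hg : Function.HasTemperateGrowth fun ξ : ℝ =>
        fattenedPiece ψ (ξ / 2 ^ j) * (Complex.I * ((ξ / 2 ^ j : ℝ) : ℂ)) :=
      (hc₁.comp_div (by positivity)).hasTemperateGrowth (contDiff_comp_div hs₁ _)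
    have hfac : (fun ξ : ℝ => dyadicPiece ψ (j + 1) ξ * (Complex.I * ξ)) = fun ξ => 2 ^ j *
        (fattenedPiece ψ (ξ / 2 ^ j) * (Complex.I * ((ξ / 2 ^ j : ℝ) : ℂ)) *
          dyadicPiece ψ (j + 1) ξ) := by
      ext ξ
      nth_rw 1 [← hψ.dyadicPiece_succ_mul_fattenedPiece j ξ]
      push_cast
      field_simp
    have hgp : Function.HasTemperateGrowth fun ξ : ℝ => fattenedPiece ψ (ξ / 2 ^ j) *
        (Complex.I * ((ξ / 2 ^ j : ℝ) : ℂ)) * dyadicPiece ψ (j + 1) ξ :=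
      hg.mul (hψ.hasTemperateGrowth_dyadicPiece _)
    rw [hfac, symbolD_const_mul hgp,
      ← symbolD_symbolD hg (hψ.hasTemperateGrowth_dyadicPiece _), Φ.distNorm_smul]
    have h2 : ‖(2 : ℂ) ^ j‖ₑ ≤ ENNReal.ofReal (2 ^ (j + 1)) := by
      rw [← ofReal_norm, norm_pow, Complex.norm_ofNat]
      exact ENNReal.ofReal_le_ofReal (pow_le_pow_right₀ one_le_two (Nat.le_succ j))
    calc _ ≤ ENNReal.ofReal (2 ^ (j + 1)) *
          (K₁ * Φ.distNorm (symbolD (dyadicPiece ψ (j + 1)) u)) :=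
          mul_le_mul' h2 (hK₁ (2 ^ j) (by positivity) _)
      _ ≤ ENNReal.ofReal (2 ^ (j + 1)) *
          ((max K₀ K₁ : ℝ≥0) * Φ.distNorm (symbolD (dyadicPiece ψ (j + 1)) u)) := by
          gcongr
          exact le_max_right _ _
      _ = _ := by ring

theorem fattenedPiece_div_mul_dyadicPiece_succ (hψ : IsDyadicGenerator ψ) (j : ℕ) (ξ : ℝ) :
    fattenedPiece ψ (ξ / 2 ^ j) / (Complex.I * ((ξ / 2 ^ j : ℝ) : ℂ)) *
      (dyadicPiece ψ (j + 1) ξ * (Complex.I * ξ)) = 2 ^ j * dyadicPiece ψ (j + 1) ξ := by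
  rcases eq_or_ne ξ 0 with rfl | hξ
  · rw [← hψ.dyadicPiece_succ_mul_fattenedPiece j 0, hψ.fattenedPiece_eq_zero (by simp)]
    simp
  · have hξ' : (ξ : ℂ) ≠ 0 := Complex.ofReal_ne_zero.2 hξ
    rw [← hψ.dyadicPiece_succ_mul_fattenedPiece j ξ]
    conv_rhs => rw [← hψ.dyadicPiece_succ_mul_fattenedPiece j ξ]
    generalize fattenedPiece ψ (ξ / 2 ^ j) = a
    generalize dyadicPiece ψ (j + 1) ξ = b
    push_cast
    field_simp

theorem symbolD_fattenedPiece_div_derivCLM (hψ : IsDyadicGenerator ψ) (j : ℕ) (u : 𝓢'(ℝ, X)) :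
    symbolD (fun ξ : ℝ => fattenedPiece ψ (ξ / 2 ^ j) / (Complex.I * ((ξ / 2 ^ j : ℝ) : ℂ)))
        (symbolD (dyadicPiece ψ (j + 1)) (TemperedDistribution.derivCLM X u)) =
      (2 ^ j : ℂ) • symbolD (dyadicPiece ψ (j + 1)) u := by
  have hg : Function.HasTemperateGrowth fun ξ : ℝ =>
      fattenedPiece ψ (ξ / 2 ^ j) / (Complex.I * ((ξ / 2 ^ j : ℝ) : ℂ)) :=
    (hψ.hasCompactSupport_fattenedPiece_div.comp_div (by positivity)).hasTemperateGrowth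
      (contDiff_comp_div hψ.contDiff_fattenedPiece_div _)
  have hp := hψ.hasTemperateGrowth_dyadicPiece (j + 1)
  have hpI : Function.HasTemperateGrowth fun ξ : ℝ =>
      dyadicPiece ψ (j + 1) ξ * (Complex.I * ξ) := hp.mul hasTemperateGrowth_I_mul
  rw [derivCLM_eq_symbolD, symbolD_symbolD hp hasTemperateGrowth_I_mul, symbolD_symbolD hg hpI,
    ← symbolD_const_mul hp]
  exact congr(symbolD $(funext (hψ.fattenedPiece_div_mul_dyadicPiece_succ j)) u)

/-- Away from the origin the derivative can be inverted: on the annular pieces it is bounded from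
below by a multiple of `2 ^ j`. -/
theorem exists_distNorm_symbolD_succ_le [CompleteSpace X] (hψ : IsDyadicGenerator ψ)
    {Φ : BanachFunctionSpace} (hM : HardyLittlewoodBoundedOn Φ.norm) :
    ∃ K : ℝ≥0, ∀ (j : ℕ) (u : 𝓢'(ℝ, X)),
      ENNReal.ofReal (2 ^ (j + 1)) * Φ.distNorm (symbolD (dyadicPiece ψ (j + 1)) u) ≤
        K * Φ.distNorm
          (symbolD (dyadicPiece ψ (j + 1)) (TemperedDistribution.derivCLM X u)) := by
  obtain ⟨K, hK⟩ := Φ.exists_distNorm_symbolD_dilate_le (X := X) hM hψ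
    hψ.hasCompactSupport_fattenedPiece_div hψ.contDiff_fattenedPiece_div
  refine ⟨2 * K, fun j u => ?_⟩
  have h2 : ENNReal.ofReal (2 ^ (j + 1)) = 2 * ‖(2 : ℂ) ^ j‖ₑ := by
    rw [← ofReal_norm, norm_pow, Complex.norm_ofNat, pow_succ', ENNReal.ofReal_mul (by norm_num),
      ENNReal.ofReal_ofNat]
  rw [h2, mul_assoc, ← Φ.distNorm_smul, ← hψ.symbolD_fattenedPiece_div_derivCLM, ENNReal.coe_mul,
    ENNReal.coe_ofNat, mul_assoc]
  exact mul_le_mul_right (hK (2 ^ j) (by positivity) _) _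

end IsDyadicGenerator
end SymbolCalculus

/-! ### Besov norms -/

section Besov

variable {ψ : ℝ → ℂ} {Φ : BanachFunctionSpace} {s : ℝ} {q : ℝ≥0∞}

/-- The `j`-th term `2^{sj} ‖ψ_j(D) f‖_{Φ(X)}` of the Besov norm. -/
noncomputable def besovTerm (ψ : ℝ → ℂ) (Φ : BanachFunctionSpace) (s : ℝ) (f : 𝓢'(ℝ, X)) (j : ℕ) :
    ℝ≥0∞ :=
  ENNReal.ofReal (2 ^ (s * j)) * Φ.distNorm (symbolD (dyadicPiece ψ j) f)

theorem besovNorm_eq_eLpNorm (hq : 1 ≤ q) (f : 𝓢'(ℝ, X)) :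
    besovNorm ψ Φ s q f = eLpNorm (besovTerm ψ Φ s f) q Measure.count := by
  unfold besovNorm
  split_ifs with h
  · rw [h, eLpNorm_exponent_top, eLpNormEssSup_count]
    rfl
  · rw [eLpNorm_eq_lintegral_rpow_enorm_toReal (one_pos.trans_le hq).ne' h, lintegral_count]
    rfl

theorem besovNorm_le_of_besovTerm_le (hq : 1 ≤ q) {s' : ℝ} {f g : 𝓢'(ℝ, X)} (K : ℝ≥0)
    (h : ∀ j, besovTerm ψ Φ s f j ≤ K * besovTerm ψ Φ s' g j) :
    besovNorm ψ Φ s q f ≤ K * besovNorm ψ Φ s' q g := by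
  rw [besovNorm_eq_eLpNorm hq, besovNorm_eq_eLpNorm hq]
  exact eLpNorm_le_nnreal_smul_eLpNorm_of_ae_le_mul' (.of_forall h) q

theorem besovNorm_add_le (hq : 1 ≤ q) (f g : 𝓢'(ℝ, X)) :
    besovNorm ψ Φ s q (f + g) ≤ besovNorm ψ Φ s q f + besovNorm ψ Φ s q g := by
  rw [besovNorm_eq_eLpNorm hq, besovNorm_eq_eLpNorm hq, besovNorm_eq_eLpNorm hq]
  refine (eLpNorm_mono_enorm fun j => ?_).trans (eLpNorm_add_le
    (Measurable.of_discrete.aestronglyMeasurable) (Measurable.of_discrete.aestronglyMeasurable) hq)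
  simp only [besovTerm, Pi.add_apply, enorm_eq_self, map_add, ← mul_add]
  gcongr
  exact Φ.distNorm_add_le _ _

theorem besovNorm_smul (hq : 1 ≤ q) (c : ℂ) (f : 𝓢'(ℝ, X)) :
    besovNorm ψ Φ s q (c • f) = ‖c‖ₑ * besovNorm ψ Φ s q f := by
  have hq0 : 0 < q := one_pos.trans_le hq
  unfold besovNorm
  simp only [map_smul, Φ.distNorm_smul, mul_left_comm _ ‖c‖ₑ]
  split_ifs with hq'
  · rw [ENNReal.mul_iSup]
  · have hr : 0 < q.toReal := ENNReal.toReal_pos hq0.ne' hq'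
    simp only [ENNReal.mul_rpow_of_nonneg _ _ hr.le]
    rw [ENNReal.tsum_mul_left, ENNReal.mul_rpow_of_nonneg _ _ (by positivity), ← ENNReal.rpow_mul,
      mul_one_div_cancel hr.ne', ENNReal.rpow_one]

theorem besovNorm_zero (hq : 1 ≤ q) : besovNorm ψ Φ s q (0 : 𝓢'(ℝ, X)) = 0 := by
  simpa using besovNorm_smul (ψ := ψ) (Φ := Φ) (s := s) hq 0 (0 : 𝓢'(ℝ, X))

theorem besovNorm_eq_zero_iff [CompleteSpace X] (hψ : IsDyadicGenerator ψ) (hq : 1 ≤ q)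
    {f : 𝓢'(ℝ, X)} : besovNorm ψ Φ s q f = 0 ↔ f = 0 := by
  refine ⟨fun h => hψ.eq_zero_of_symbolD_dyadicPiece fun j => ?_, fun h => h ▸ besovNorm_zero hq⟩
  rw [besovNorm_eq_eLpNorm hq, eLpNorm_eq_zero_iff Measurable.of_discrete.aestronglyMeasurable
    (one_pos.trans_le hq).ne'] at h
  have hj : besovTerm ψ Φ s f j = 0 := Measure.ae_count_iff.1 h j
  refine Φ.eq_zero_of_distNorm_eq_zero hψ ((mul_eq_zero.1 hj).resolve_left ?_)
  rw [ENNReal.ofReal_eq_zero, not_le]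
  positivity

theorem isNormOn_besovNorm [CompleteSpace X] (hψ : IsDyadicGenerator ψ) (hq : 1 ≤ q) :
    IsNormOn (besovSpace X ψ Φ s q) (besovNorm ψ Φ s q) where
  zero_mem := (besovNorm_zero hq).trans_lt ENNReal.zero_lt_top
  add_mem _ hf _ hg := (besovNorm_add_le hq _ _).trans_lt (ENNReal.add_lt_top.2 ⟨hf, hg⟩)
  smul_mem c _ hf := (besovNorm_smul hq c _).trans_lt (ENNReal.mul_lt_top enorm_lt_top hf)
  lt_top _ hf := hf
  eq_zero_iff _ _ := besovNorm_eq_zero_iff hψ hq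
  smul c _ _ := besovNorm_smul hq c _
  add_le _ _ _ _ := besovNorm_add_le hq _ _

theorem besovTerm_eq (s : ℝ) (f : 𝓢'(ℝ, X)) (j : ℕ) :
    besovTerm ψ Φ s f j = ENNReal.ofReal (2 ^ ((s - 1) * j)) *
      (ENNReal.ofReal (2 ^ j) * Φ.distNorm (symbolD (dyadicPiece ψ j) f)) := by
  rw [besovTerm, ← mul_assoc, ← ENNReal.ofReal_mul (by positivity), ← Real.rpow_natCast,
    ← Real.rpow_add two_pos]
  congr 3
  ring

theorem besovNorm_sub_one_le (hq : 1 ≤ q) (f : 𝓢'(ℝ, X)) :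
    besovNorm ψ Φ (s - 1) q f ≤ besovNorm ψ Φ s q f := by
  have := besovNorm_le_of_besovTerm_le (ψ := ψ) (Φ := Φ) (s := s - 1) (s' := s) hq (f := f)
    (g := f) 1 fun j => ?_
  · simpa using this
  rw [besovTerm_eq s, besovTerm, ENNReal.coe_one, one_mul]
  gcongr
  refine le_mul_of_one_le_left zero_le ?_
  exact ENNReal.one_le_ofReal.2 (one_le_pow₀ one_le_two)

theorem exists_besovNorm_derivCLM_le [CompleteSpace X] (hM : HardyLittlewoodBoundedOn Φ.norm)
    (hψ : IsDyadicGenerator ψ) (s : ℝ) (hq : 1 ≤ q) : ∃ K : ℝ≥0, ∀ f : 𝓢'(ℝ, X),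
      besovNorm ψ Φ (s - 1) q (TemperedDistribution.derivCLM X f) ≤
        K * besovNorm ψ Φ s q f := by
  obtain ⟨K, hK⟩ := hψ.exists_distNorm_symbolD_derivCLM_le (X := X) hM
  refine ⟨K, fun f => besovNorm_le_of_besovTerm_le hq K fun j => ?_⟩
  rw [besovTerm_eq s, besovTerm, mul_left_comm, ← mul_assoc (K : ℝ≥0∞)]
  exact mul_le_mul_right (hK j f) _

theorem exists_besovNorm_le_add [CompleteSpace X] (hM : HardyLittlewoodBoundedOn Φ.norm)
    (hψ : IsDyadicGenerator ψ) (s : ℝ) (hq : 1 ≤ q) : ∃ K : ℝ≥0, ∀ f : 𝓢'(ℝ, X),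
      besovNorm ψ Φ s q f ≤ K * (besovNorm ψ Φ (s - 1) q f +
        besovNorm ψ Φ (s - 1) q (TemperedDistribution.derivCLM X f)) := by
  obtain ⟨K, hK⟩ := hψ.exists_distNorm_symbolD_succ_le (X := X) hM
  refine ⟨max 1 K, fun f => ?_⟩
  set g := TemperedDistribution.derivCLM X f
  have hterm : ∀ j, besovTerm ψ Φ s f j ≤
      (max 1 K : ℝ≥0) * (besovTerm ψ Φ (s - 1) f j + besovTerm ψ Φ (s - 1) g j) := by
    intro j
    cases j with
    | zero =>
      -- the piece around the origin is controlled by `f` alone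
      have h0 : besovTerm ψ Φ s f 0 = besovTerm ψ Φ (s - 1) f 0 := by simp [besovTerm]
      rw [h0]
      refine le_self_add.trans (le_mul_of_one_le_left zero_le ?_)
      exact_mod_cast le_max_left 1 K
    | succ j =>
      calc besovTerm ψ Φ s f (j + 1) ≤ ENNReal.ofReal (2 ^ ((s - 1) * (j + 1 : ℕ))) *
            (K * Φ.distNorm (symbolD (dyadicPiece ψ (j + 1)) g)) := by
            rw [besovTerm_eq]
            exact mul_le_mul_right (hK j f) _
        _ = K * besovTerm ψ Φ (s - 1) g (j + 1) := by rw [besovTerm, mul_left_comm]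
        _ ≤ _ := by
            gcongr
            · exact le_max_right _ _
            · exact le_add_self
  rw [besovNorm_eq_eLpNorm hq, besovNorm_eq_eLpNorm hq, besovNorm_eq_eLpNorm hq]
  refine (eLpNorm_le_nnreal_smul_eLpNorm_of_ae_le_mul'
    (g := besovTerm ψ Φ (s - 1) f + besovTerm ψ Φ (s - 1) g) (.of_forall hterm) q).trans ?_
  rw [ENNReal.smul_def, smul_eq_mul]
  gcongr
  exact eLpNorm_add_le Measurable.of_discrete.aestronglyMeasurable
    Measurable.of_discrete.aestronglyMeasurable hq

end Besov

end

theorem mainTheorem8 {X : Type*} [NormedAddCommGroup X] [NormedSpace ℂ X] [CompleteSpace X]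
    (Φ : BanachFunctionSpace)
    (hM : HardyLittlewoodBoundedOn Φ.norm) (hM' : HardyLittlewoodBoundedOn Φ.dualNorm)
    (ψ : ℝ → ℂ) (hψ : IsDyadicGenerator ψ) (s : ℝ) (q : ℝ≥0∞) (hq : 1 ≤ q) :
    (∀ f : 𝓢'(ℝ, X), f ∈ besovSpace X ψ Φ s q ↔
      f ∈ besovSpace X ψ Φ (s - 1) q ∧
        TemperedDistribution.derivCLM X f ∈ besovSpace X ψ Φ (s - 1) q) ∧
    AreEquivalentNormsOn (besovSpace X ψ Φ s q) (besovNorm ψ Φ s q)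
      (fun f => besovNorm ψ Φ (s - 1) q f +
        besovNorm ψ Φ (s - 1) q (TemperedDistribution.derivCLM X f)) := by
  obtain ⟨K₁, h₁⟩ := exists_besovNorm_derivCLM_le (X := X) hM hψ s hq
  obtain ⟨K₂, h₂⟩ := exists_besovNorm_le_add (X := X) hM hψ s hq
  have hfst : ∀ f : 𝓢'(ℝ, X), besovNorm ψ Φ (s - 1) q f ≤ besovNorm ψ Φ s q f :=
    besovNorm_sub_one_le hq
  have hiff : ∀ f : 𝓢'(ℝ, X), f ∈ besovSpace X ψ Φ s q ↔
      f ∈ besovSpace X ψ Φ (s - 1) q ∧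
        TemperedDistribution.derivCLM X f ∈ besovSpace X ψ Φ (s - 1) q := fun f =>
    ⟨fun hf => ⟨(hfst f).trans_lt hf, (h₁ f).trans_lt (ENNReal.mul_lt_top ENNReal.coe_lt_top hf)⟩,
      fun hf => (h₂ f).trans_lt
        (ENNReal.mul_lt_top ENNReal.coe_lt_top (ENNReal.add_lt_top.2 hf))⟩
  have hN := isNormOn_besovNorm (X := X) (Φ := Φ) (s := s) hψ hq
  refine ⟨hiff, hN, ?_, ?_⟩
  · refine ⟨hN.zero_mem, hN.add_mem, hN.smul_mem,
      fun f hf => ENNReal.add_lt_top.2 ((hiff f).1 hf), fun f _ => ?_, fun c f _ => ?_,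
      fun f _ g _ => ?_⟩
    · rw [add_eq_zero, besovNorm_eq_zero_iff hψ hq, besovNorm_eq_zero_iff hψ hq,
        and_iff_left_iff_imp]
      rintro rfl
      exact map_zero _
    · rw [map_smul, besovNorm_smul hq, besovNorm_smul hq, mul_add]
    · rw [map_add]
      exact (add_le_add (besovNorm_add_le hq _ _) (besovNorm_add_le hq _ _)).trans_eq
        (add_add_add_comm _ _ _ _)
  · refine ⟨(K₂ + 1)⁻¹, 1 + K₁, by positivity, by positivity, fun f _ => ⟨?_, ?_⟩⟩
    · rw [ENNReal.coe_inv (by positivity), mul_comm, ← div_eq_mul_inv]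
      refine ENNReal.div_le_of_le_mul' ((h₂ f).trans ?_)
      push_cast
      gcongr
      exact le_self_add
    · push_cast
      rw [add_mul, one_mul]
      exact add_le_add (hfst f) (h₁ f)
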